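/- Let $\mathcal G_\bullet$ be the space of isomorphism classes $[\Gamma,x]$ of locally finite (finite or infinite) connected simple graphs $\Gamma$ with a root $x$, and $\mathcal G_{\bullet\bullet}$ the space of isomorphism classes $[\Gamma,x,y]$ of such graphs with two (possibly equal) roots, both with the projective limit topology (convergence means that all balls around the roots stabilize) and its Borel $\sigma$-algebra. Let $\mathcal R\subset\mathcal G_\bullet\times\mathcal G_\bullet$ be the root moving equivalence relation $\{([\Gamma,x],[\Gamma,y])\}$, with the involution $j(\xi,\eta)=(\eta,\xi)$; let $J[\Gamma,x,y]=[\Gamma,y,x]$ and $\sigma[\Gamma,x,y]=([\Gamma,x],[\Gamma,y])$. For a graph $\Gamma$ with automorphism group $G$ let $G_xy$ be the orbit of the vertex $y$ under the stabilizer $G_x$ of $x$; the modular function is $$\Delta_{\bullet\bullet}[\Gamma,x,y]=\frac{\operatorname{card}G_xy}{\operatorname{card}G_yx}.$$ For $\xi\in\mathcal G_\bullet$ let $N_\xi$ be the counting measure on $\{(\xi,\eta)\in\mathcal R\}$, and let $\mathcal N_\xi$ be the measure on $\{[\Gamma,x,y]:[\Gamma,x]=\xi\}$ with mass $\operatorname{card}G_xy$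 at the point $[\Gamma,x,y]$. For a $\sigma$-finite Borel measure $\mu$ on $\mathcal G_\bullet$ (for instance, a probability measure) put $$M_{\mathcal R}=\int N_\xi\,d\mu(\xi),\qquad M_{\bullet\bullet}=\int\mathcal N_\xi\,d\mu(\xi).$$ The measure $\mu$ is $\mathcal R$-quasi-invariant if $M_{\mathcal R}$ and its image $jM_{\mathcal R}$ are equivalent (have the same null sets), and quasi-unimodular if $M_{\bullet\bullet}$ and its image $JM_{\bullet\bullet}$ are equivalent. **Theorem.** The maps $\xi\mapsto N_\xi$ and $\xi\mapsto\mathcal N_\xi$ are measurable. Let $\mu$ be an $\mathcal R$-quasi-invariant $\sigma$-finite Borel measure on $\mathcal G_\bullet$. Then the Radon–Nikodym derivative $D_\mu=\dfrac{d\,jM_{\mathcal R}}{d\,M_{\mathcal R}}$ exists (that is, $jM_{\mathcal R}=D_\mu\,M_{\mathcal R}$), the measure $\mu$ is quasi-unimodular, and $$\frac{d\,JM_{\bullet\bullet}}{d\,M_{\bullet\bullet}}(\theta)=\frac{D_\mu(\sigma(\theta))}{\Delta_{\bullet\bullet}(\theta)}\qquad\text{for }M_{\bullet\bullet}\text{-almost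 every }\theta\in\mathcal G_{\bullet\bullet},$$ the right-hand side being a density: $JM_{\bullet\bullet}=\dfrac{D_\mu\circ\sigma}{\Delta_{\bullet\bullet}}\,M_{\bullet\bullet}$. -/

import Mathlib

open MeasureTheory
open scoped ENNReal

noncomputable section

namespace RandomGraphs

/-- A locally finite connected graph without loops or multiple edges (possibly finite). Such a
graph is countable, so vertex sets in `Type` give all of them up to isomorphism. -/
structure LFGraph where
  /-- the vertex set -/
  V : Type
  /-- the graph structure -/
  graph : SimpleGraph V
  locallyFinite : ∀ v, (graph.neighborSet v).Finite
  connected : graph.Connected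

/-- A locally finite connected graph with `k` distinguished vertices (roots), which need not be
distinct. Rooted graphs are the case `k = 1`, doubly rooted graphs the case `k = 2`. -/
structure Rooted (k : ℕ) where
  /-- the underlying graph -/
  Γ : LFGraph
  /-- the roots -/
  root : Fin k → Γ.V

namespace Rooted

variable {k l : ℕ}

/-- Isomorphism of graphs with `k` roots. -/
def Iso (A B : Rooted k) : Prop :=
  ∃ e : A.Γ.graph ≃g B.Γ.graph, ∀ i, e (A.root i) = B.root i

theorem Iso.refl (A : Rooted k) : A.Iso A := ⟨SimpleGraph.Iso.refl, fun _ => rfl⟩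

theorem Iso.symm {A B : Rooted k} : A.Iso B → B.Iso A := by
  rintro ⟨e, he⟩
  refine ⟨e.symm, fun i => ?_⟩
  rw [← he i]
  exact e.symm_apply_apply _

theorem Iso.trans {A B C : Rooted k} : A.Iso B → B.Iso C → A.Iso C := by
  rintro ⟨e, he⟩ ⟨f, hf⟩
  refine ⟨e.trans f, fun i => ?_⟩
  rw [← hf i, ← he i]
  rfl

instance setoid (k : ℕ) : Setoid (Rooted k) :=
  ⟨Iso, Iso.refl, Iso.symm, Iso.trans⟩

/-- The vertices at graph distance at most `r` from one of the roots. -/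
def ball (r : ℕ) (A : Rooted k) : Set A.Γ.V :=
  {v | ∃ i, A.Γ.graph.dist (A.root i) v ≤ r}

theorem root_mem_ball (r : ℕ) (A : Rooted k) (i : Fin k) : A.root i ∈ A.ball r :=
  ⟨i, by simp⟩

/-- The `r`-balls around the roots, as induced subgraphs with the same roots, are isomorphic. -/
def SameBall (r : ℕ) (A B : Rooted k) : Prop :=
  ∃ e : A.Γ.graph.induce (A.ball r) ≃g B.Γ.graph.induce (B.ball r),
    ∀ i, e ⟨A.root i, A.root_mem_ball r i⟩ = ⟨B.root i, B.root_mem_ball r i⟩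

/-- Take the roots with numbers `f 0, f 1, …` as the new roots, keeping the graph. -/
def reindex (f : Fin l → Fin k) (A : Rooted k) : Rooted l := ⟨A.Γ, A.root ∘ f⟩

end Rooted

/-- The space of isomorphism classes of locally finite connected graphs with `k` roots. -/
def Gr (k : ℕ) : Type 1 := Quotient (Rooted.setoid k)

namespace Gr

variable {k l : ℕ}

/-- The isomorphism class of `(Γ, root)`. -/
def mk (A : Rooted k) : Gr k := Quotient.mk (Rooted.setoid k) A

/-- The classes of the graphs whose `r`-ball around the roots looks like that of `A`. -/
def cylinder (r : ℕ) (A : Rooted k) : Set (Gr k) :=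
  {ξ | ∃ B : Rooted k, mk B = ξ ∧ A.SameBall r B}

/-- The projective limit topology: `ξₙ → ξ` if and only if all balls around the roots stabilize. -/
instance : TopologicalSpace (Gr k) :=
  TopologicalSpace.generateFrom {U | ∃ (r : ℕ) (A : Rooted k), U = cylinder r A}

instance : MeasurableSpace (Gr k) := borel (Gr k)

instance : BorelSpace (Gr k) := ⟨rfl⟩

/-- Take the roots with numbers `f 0, f 1, …` as the new roots, keeping the graph. -/
def reindex (f : Fin l → Fin k) : Gr k → Gr l :=
  Quotient.lift (fun A => mk (A.reindex f)) fun _ _ ⟨e, he⟩ =>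
    Quotient.sound ⟨e, fun i => he (f i)⟩

end Gr

/-- The space of rooted graphs. -/
abbrev Gr₁ : Type 1 := Gr 1

/-- The space of doubly rooted graphs; root `0` is the primary one, root `1` the secondary one. -/
abbrev Gr₂ : Type 1 := Gr 2

/-- The class of the rooted graph `(Γ, x)`. -/
def cls₁ (Γ : LFGraph) (x : Γ.V) : Gr₁ := Gr.mk ⟨Γ, ![x]⟩

/-- The class of the doubly rooted graph `(Γ, x, y)`. -/
def cls₂ (Γ : LFGraph) (x y : Γ.V) : Gr₂ := Gr.mk ⟨Γ, ![x, y]⟩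

/-- The projection `(Γ, x, y) ↦ (Γ, x)`. -/
def primary : Gr₂ → Gr₁ := Gr.reindex ![0]

/-- The projection `(Γ, x, y) ↦ (Γ, y)`. -/
def secondary : Gr₂ → Gr₁ := Gr.reindex ![1]

/-- The involution `(Γ, x, y) ↦ (Γ, y, x)` of the space of doubly rooted graphs. -/
def swapRoots : Gr₂ → Gr₂ := Gr.reindex ![1, 0]

theorem vec_one_comp {α : Type*} (a : Fin 2 → α) (i : Fin 2) : a ∘ ![i] = ![a i] := by
  funext j; fin_cases j; rfl

theorem primary_cls₂ (Γ : LFGraph) (x y : Γ.V) : primary (cls₂ Γ x y) = cls₁ Γ x :=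
  congrArg (fun a => Gr.mk ⟨Γ, a⟩) (vec_one_comp ![x, y] 0)

theorem secondary_cls₂ (Γ : LFGraph) (x y : Γ.V) : secondary (cls₂ Γ x y) = cls₁ Γ y :=
  congrArg (fun a => Gr.mk ⟨Γ, a⟩) (vec_one_comp ![x, y] 1)

theorem swapRoots_cls₂ (Γ : LFGraph) (x y : Γ.V) : swapRoots (cls₂ Γ x y) = cls₂ Γ y x :=
  congrArg (fun a => Gr.mk ⟨Γ, a⟩) (by funext j; fin_cases j <;> rfl)

theorem exists_cls₂ (θ : Gr₂) : ∃ (Γ : LFGraph) (x y : Γ.V), θ = cls₂ Γ x y := by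
  induction θ using Quotient.inductionOn with
  | h A =>
    refine ⟨A.Γ, A.root 0, A.root 1, ?_⟩
    refine congrArg (fun a => Gr.mk ⟨A.Γ, a⟩) ?_
    funext j; fin_cases j <;> rfl

/-- The root moving equivalence relation: two rooted graphs are equivalent if they are (up to
isomorphism) rootings of the same graph. -/
def rootMoving : Set (Gr₁ × Gr₁) :=
  {p | ∃ (Γ : LFGraph) (x y : Γ.V), p = (cls₁ Γ x, cls₁ Γ y)}

/-- The involution `(ξ, η) ↦ (η, ξ)` of the root moving equivalence relation. -/
def swapPair (p : rootMoving) : rootMoving :=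
  ⟨p.1.swap, by
    obtain ⟨_, Γ, x, y, rfl⟩ := p
    exact ⟨Γ, y, x, rfl⟩⟩

/-- The map `(Γ, x, y) ↦ ((Γ, x), (Γ, y))` from doubly rooted graphs to the root moving
equivalence relation. -/
def rootPair (θ : Gr₂) : rootMoving :=
  ⟨(primary θ, secondary θ), by
    obtain ⟨Γ, x, y, rfl⟩ := exists_cls₂ θ
    exact ⟨Γ, x, y, by rw [primary_cls₂, secondary_cls₂]⟩⟩

/-- The orbit of the vertex `y` under the stabilizer of the vertex `x` in the automorphism group
of the graph. -/
def stabOrbit (Γ : LFGraph) (x y : Γ.V) : Set Γ.V :=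
  {z | ∃ g : Γ.graph ≃g Γ.graph, g x = x ∧ g y = z}

/-- The number of points of `stabOrbit Γ x y` (always finite and non-zero). -/
def stabOrbitCard (Γ : LFGraph) (x y : Γ.V) : ℝ≥0∞ := ((stabOrbit Γ x y).encard : ℝ≥0∞)

/-- The modular cocycle `Δ_Γ(x, y) = card (G_x y) / card (G_y x)` of a graph. -/
def modularCocycle (Γ : LFGraph) (x y : Γ.V) : ℝ≥0∞ :=
  stabOrbitCard Γ x y / stabOrbitCard Γ y x

theorem stabOrbit_image {Γ Γ' : LFGraph} (e : Γ.graph ≃g Γ'.graph) (x y : Γ.V) :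
    stabOrbit Γ' (e x) (e y) = e '' stabOrbit Γ x y := by
  ext z
  constructor
  · rintro ⟨g, hx, hy⟩
    refine ⟨e.symm z, ⟨(e.trans g).trans e.symm, ?_, ?_⟩, e.apply_symm_apply z⟩
    · change e.symm (g (e x)) = x
      rw [hx]; exact e.symm_apply_apply x
    · change e.symm (g (e y)) = _
      rw [hy]
  · rintro ⟨w, ⟨g, hx, hy⟩, rfl⟩
    refine ⟨(e.symm.trans g).trans e, ?_, ?_⟩
    · change e (g (e.symm (e x))) = e x
      rw [e.symm_apply_apply, hx]
    · change e (g (e.symm (e y))) = e w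
      rw [e.symm_apply_apply, hy]

theorem stabOrbitCard_iso {Γ Γ' : LFGraph} (e : Γ.graph ≃g Γ'.graph) (x y : Γ.V) :
    stabOrbitCard Γ' (e x) (e y) = stabOrbitCard Γ x y := by
  rw [stabOrbitCard, stabOrbitCard, stabOrbit_image, e.injective.encard_image]

/-- The function `(Γ, x, y) ↦ card (G_x y)` on isomorphism classes. -/
def orbitWeight : Gr₂ → ℝ≥0∞ :=
  Quotient.lift (fun A => stabOrbitCard A.Γ (A.root 0) (A.root 1)) fun A B ⟨e, he⟩ => by
    rw [← he 0, ← he 1, stabOrbitCard_iso]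

/-- The modular function on the space of doubly rooted graphs, the value of the modular cocycle
of `Γ` at `(x, y)` for the class of `(Γ, x, y)`. -/
def modularFunction : Gr₂ → ℝ≥0∞ :=
  Quotient.lift (fun A => modularCocycle A.Γ (A.root 0) (A.root 1)) fun A B ⟨e, he⟩ => by
    rw [modularCocycle, modularCocycle, ← he 0, ← he 1, stabOrbitCard_iso, stabOrbitCard_iso]

/-- The counting measure on the fiber over `ξ` of the projection `(ξ, η) ↦ ξ` of the root moving
equivalence relation. -/
def fiberCount (ξ : Gr₁) : Measure rootMoving :=
  Measure.sum fun p : {p : rootMoving // p.1.1 = ξ} => Measure.dirac p.1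

/-- The measure on the fiber over `ξ` of the projection `primary`, with mass `card (G_x y)` at the
class of `(Γ, x, y)`; for `ξ` the class of `(Γ, x)` it is the image of the counting measure on the
vertices of `Γ` under `y ↦ (Γ, x, y)`. -/
def fiberWeight (ξ : Gr₁) : Measure Gr₂ :=
  Measure.sum fun θ : {θ : Gr₂ // primary θ = ξ} => orbitWeight θ.1 • Measure.dirac θ.1

/-- The counting measure `∫ fiberCount ξ dμ(ξ)` on the root moving equivalence relation. -/
def countingR (μ : Measure Gr₁) : Measure rootMoving := μ.bind fiberCount

/-- The counting measure `∫ fiberWeight ξ dμ(ξ)` on the space of doubly rooted graphs. -/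
def countingGr₂ (μ : Measure Gr₁) : Measure Gr₂ := μ.bind fiberWeight

/-- A measure is quasi-invariant under a map if it is equivalent to its image. -/
def IsQuasiInvariantUnder {X : Type*} [MeasurableSpace X] (m : Measure X) (f : X → X) : Prop :=
  m.map f ≪ m ∧ m ≪ m.map f

/-- Quasi-invariance with respect to the root moving equivalence relation. -/
def QuasiInvariant (μ : Measure Gr₁) : Prop := IsQuasiInvariantUnder (countingR μ) swapPair

/-- Quasi-unimodularity. -/
def QuasiUnimodular (μ : Measure Gr₁) : Prop := IsQuasiInvariantUnder (countingGr₂ μ) swapRoots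

/-- The Radon–Nikodym cocycle of `μ` with respect to the root moving equivalence relation. -/
def rnCocycle (μ : Measure Gr₁) : rootMoving → ℝ≥0∞ :=
  ((countingR μ).map swapPair).rnDeriv (countingR μ)

theorem measurable_swapPair : Measurable swapPair :=
  (measurable_swap.comp measurable_subtype_coe).subtype_mk

namespace Rooted

variable {k l : ℕ}

theorem Iso.sameBall {A B : Rooted k} (h : A.Iso B) (r : ℕ) : A.SameBall r B := by
  obtain ⟨e, he⟩ := h
  have hd : ∀ u v, B.Γ.graph.dist (e u) (e v) = A.Γ.graph.dist u v := by
    have key : ∀ {C D : LFGraph} (f : C.graph ≃g D.graph) (u v : C.V),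
        D.graph.dist (f u) (f v) ≤ C.graph.dist u v := by
      intro C D f u v
      obtain ⟨p, hp⟩ := C.connected.exists_walk_length_eq_dist u v
      rw [← hp, ← SimpleGraph.Walk.length_map f.toHom p]
      exact SimpleGraph.dist_le _
    intro u v
    refine le_antisymm (key e u v) ?_
    have := key e.symm (e u) (e v)
    rwa [e.symm_apply_apply, e.symm_apply_apply] at this
  have hm : ∀ v, v ∈ A.ball r ↔ e v ∈ B.ball r := by
    intro v
    simp only [ball, Set.mem_ofPred_eq]
    refine exists_congr fun i => ?_
    rw [← he i, hd]
  exact ⟨⟨e.toEquiv.subtypeEquiv hm, e.map_adj_iff⟩, fun i => Subtype.ext (he i)⟩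

theorem SameBall.symm {r : ℕ} {A B : Rooted k} (h : A.SameBall r B) : B.SameBall r A := by
  obtain ⟨e, he⟩ := h
  exact ⟨e.symm, fun i => by rw [← he i]; exact e.symm_apply_apply _⟩

theorem SameBall.trans {r : ℕ} {A B C : Rooted k} (h : A.SameBall r B) (h' : B.SameBall r C) :
    A.SameBall r C := by
  obtain ⟨e, he⟩ := h
  obtain ⟨f, hf⟩ := h'
  exact ⟨e.trans f, fun i => by rw [← hf i, ← he i]; rfl⟩

theorem SameBall.reindex {r : ℕ} {A B : Rooted k} (h : A.SameBall r B) (f : Fin l → Fin k) :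
    (A.reindex f).SameBall r (B.reindex f) := by
  obtain ⟨e, he⟩ := h
  have key : ∀ {A B : Rooted k} (e : A.Γ.graph.induce (A.ball r) ≃g B.Γ.graph.induce (B.ball r)),
      (∀ i, e ⟨A.root i, A.root_mem_ball r i⟩ = ⟨B.root i, B.root_mem_ball r i⟩) →
      ∀ (i : Fin k) (v : A.ball r), A.Γ.graph.dist (A.root i) v ≤ r →
        B.Γ.graph.dist (B.root i) (e v) ≤ r := by
    intro A B e he i v hv
    obtain ⟨p, hp⟩ := A.Γ.connected.exists_walk_length_eq_dist (A.root i) v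
    have hs : ∀ u ∈ p.support, u ∈ A.ball r := fun u hu => by
      classical
      exact ⟨i, ((SimpleGraph.dist_le (p.takeUntil u hu)).trans
        (p.length_takeUntil_le_length hu)).trans (hp ▸ hv)⟩
    have h1 : ((p.induce (A.ball r) hs).map e.toHom).length = p.length := by
      have h0 := congrArg SimpleGraph.Walk.length (SimpleGraph.Walk.map_induce p hs)
      exact (SimpleGraph.Walk.length_map _ _).trans
        ((SimpleGraph.Walk.length_map _ _).symm.trans h0)
    have h2 := SimpleGraph.dist_le
      (((p.induce (A.ball r) hs).map e.toHom).map (SimpleGraph.Embedding.induce (B.ball r)).toHom)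
    rw [SimpleGraph.Walk.length_map, h1, hp] at h2
    have h3 : (SimpleGraph.Embedding.induce (G := B.Γ.graph) (B.ball r)).toHom
        (e.toHom ⟨A.root i, A.root_mem_ball r i⟩) = B.root i := congrArg Subtype.val (he i)
    rw [h3] at h2
    exact h2.trans hv
  have hsub : ∀ C : Rooted k, (C.reindex f).ball r ⊆ C.ball r := fun C v ⟨i, hi⟩ => ⟨f i, hi⟩
  have he' : ∀ i, e.symm ⟨B.root i, B.root_mem_ball r i⟩ = ⟨A.root i, A.root_mem_ball r i⟩ :=
    fun i => by rw [← he i]; exact e.symm_apply_apply _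
  refine ⟨⟨⟨fun v => ⟨(e ⟨v.1, hsub A v.2⟩).1, ?_⟩, fun v => ⟨(e.symm ⟨v.1, hsub B v.2⟩).1, ?_⟩, ?_, ?_⟩,
    ?_⟩, fun i => ?_⟩
  · obtain ⟨i, hi⟩ := v.2
    exact ⟨i, key e he (f i) ⟨v.1, hsub A v.2⟩ hi⟩
  · obtain ⟨i, hi⟩ := v.2
    exact ⟨i, key e.symm he' (f i) ⟨v.1, hsub B v.2⟩ hi⟩
  · intro v
    refine Subtype.ext ?_
    change (e.symm (e ⟨v.1, hsub A v.2⟩)).1 = v.1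
    rw [e.symm_apply_apply]
  · intro v
    refine Subtype.ext ?_
    change (e (e.symm ⟨v.1, hsub B v.2⟩)).1 = v.1
    rw [e.apply_symm_apply]
  · intro u v
    exact e.map_adj_iff (v := ⟨u.1, hsub A u.2⟩) (w := ⟨v.1, hsub A v.2⟩)
  · refine Subtype.ext ?_
    exact (congrArg Subtype.val (he (f i)) :)

end Rooted

theorem Gr.continuous_reindex {k l : ℕ} (f : Fin l → Fin k) : Continuous (Gr.reindex f) := by
  refine continuous_generateFrom_iff.2 ?_
  rintro _ ⟨r, C, rfl⟩
  refine isOpen_iff_forall_mem_open.2 fun ξ hξ => ?_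
  induction ξ using Quotient.inductionOn with
  | h A =>
    obtain ⟨B, hB, hCB⟩ := hξ
    have hBA : B.Iso (A.reindex f) := Quotient.exact hB
    refine ⟨Gr.cylinder r A, ?_, TopologicalSpace.isOpen_generateFrom_of_mem ⟨r, A, rfl⟩,
      ⟨A, rfl, (Rooted.Iso.refl A).sameBall r⟩⟩
    rintro _ ⟨A', rfl, hA'⟩
    exact ⟨A'.reindex f, rfl, (hCB.trans (hBA.sameBall r)).trans (hA'.reindex f)⟩

theorem measurable_swapRoots : Measurable swapRoots := (Gr.continuous_reindex _).measurable

theorem measurable_primary : Measurable primary := (Gr.continuous_reindex _).measurable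

theorem measurable_rootPair : Measurable rootPair :=
  (measurable_primary.prodMk (Gr.continuous_reindex _).measurable).subtype_mk

end RandomGraphs

end

open RandomGraphs

/-!
The counting measure on doubly rooted graphs is compared with the one on the root moving relation
by summing over the fibers of `rootPair`. Write `w` for `orbitWeight`, `J` for `swapRoots` and `j`
for `swapPair`, and let `fiberSum h p` be the sum of `h` over the fiber of `rootPair` over `p`. Then
`∫ h dM•• = ∫ fiberSum (w * h) dM_R` (`lintegral_countingGr₂_eq_countingR`). The involution `J` maps
the fiber over `p` to the fiber over `j p`, hence `fiberSum (h ∘ J) = fiberSum h ∘ j`. If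
`j M_R = D M_R`, it follows that
`∫ h d(J M••) = ∫ fiberSum (w * (h ∘ J)) dM_R = ∫ fiberSum ((w ∘ J) * h) ∘ j dM_R
  = ∫ D * fiberSum ((w ∘ J) * h) dM_R = ∫ ((w ∘ J) / w) * (D ∘ rootPair) * h dM••`,
and `w / (w ∘ J)` is the modular function (`map_swapRoots_countingGr₂`).

What remains is measurability and `σ`-finiteness. No selection theorem for the countable-to-one map
`rootPair` is needed, because everything can be expressed by the weighted fiber measures, which vary
continuously. Indeed `fiberWeight` over the class of `(Γ, x)` is the image of the counting measure
on the vertices `y` of `Γ` under `y ↦ (Γ, x, y)`. So the mass of the doubly rooted graphs with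
`dist x y = n` and prescribed `r`-ball depends only on the `(r + n)`-ball around `x`
(`measurable_fiberWeight_of_isDetermined`). After damping by `tameWeight` these measures are bounded
and form a finite kernel, by a `π`-system argument; removing the density shows that `fiberWeight` is
an `s`-finite kernel. The topology is second countable, as there are countably many finite balls,
and Hausdorff, by König's lemma (`Rooted.iso_of_forall_sameBall`), so diagonals are measurable. This
yields the measurability of `w`, of `fiberSum h`, and of `fiberCount`, which is obtained from
`fiberWeight` by normalizing a positive weight that is summable over each fiber of `rootPair`. The
same weights give `σ`-finiteness of the counting measures, and thereby Radon–Nikodym derivatives.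
-/

noncomputable section

namespace RandomGraphs

/-! ### Balls in locally finite graphs -/

/-- A homomorphism defined on an induced subgraph which contains an `r`-ball does not increase
distances up to `r` from the centre of that ball: a geodesic stays inside the subgraph. -/
theorem dist_map_le {V W : Type*} {G : SimpleGraph V} {H : SimpleGraph W} (hG : G.Connected)
    {s : Set V} {t : Set W} (e : G.induce s →g H.induce t) {r : ℕ} {u v : s}
    (hs : ∀ w, G.dist u w ≤ r → w ∈ s) (hv : G.dist u v ≤ r) :
    H.dist (e u) (e v) ≤ G.dist u v := by
  classical
  obtain ⟨p, hp⟩ := hG.exists_walk_length_eq_dist (u : V) v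
  have hps : ∀ w ∈ p.support, w ∈ s := fun w hw =>
    hs w (((SimpleGraph.dist_le (p.takeUntil w hw)).trans
      (p.length_takeUntil_le_length hw)).trans (hp ▸ hv))
  have h1 : ((p.induce s hps).map e).length = p.length := by
    have h0 := congrArg SimpleGraph.Walk.length (SimpleGraph.Walk.map_induce p hps)
    exact (SimpleGraph.Walk.length_map _ _).trans
      ((SimpleGraph.Walk.length_map _ _).symm.trans h0)
  have h2 := SimpleGraph.dist_le
    (((p.induce s hps).map e).map (SimpleGraph.Embedding.induce t).toHom)
  rw [SimpleGraph.Walk.length_map, h1, hp] at h2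
  exact h2

theorem finite_walk_ends (Γ : LFGraph) (n : ℕ) (x : Γ.V) :
    {v | ∃ p : Γ.graph.Walk x v, p.length = n}.Finite := by
  induction n generalizing x with
  | zero =>
    refine (Set.finite_singleton x).subset ?_
    rintro v ⟨p, hp⟩
    exact (SimpleGraph.Walk.eq_of_length_eq_zero hp).symm
  | succ n ih =>
    refine ((Γ.locallyFinite x).biUnion fun y _ => ih y).subset ?_
    rintro v ⟨p, hp⟩
    cases p with
    | nil => simp at hp
    | cons h q => exact Set.mem_biUnion h ⟨q, by simpa using hp⟩

theorem finite_dist_le (Γ : LFGraph) (r : ℕ) (x : Γ.V) : {v | Γ.graph.dist x v ≤ r}.Finite := by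
  refine ((Set.finite_Iic r).biUnion fun n _ => finite_walk_ends Γ n x).subset ?_
  intro v hv
  obtain ⟨p, hp⟩ := Γ.connected.exists_walk_length_eq_dist x v
  exact Set.mem_biUnion (show Γ.graph.dist x v ∈ Set.Iic r from hv) ⟨p, hp⟩

namespace Rooted

variable {k l : ℕ}

theorem finite_ball (r : ℕ) (A : Rooted k) : (A.ball r).Finite := by
  have : A.ball r = ⋃ i, {v | A.Γ.graph.dist (A.root i) v ≤ r} := by
    ext v; simp [ball]
  rw [this]
  exact Set.finite_iUnion fun i => finite_dist_le _ _ _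

theorem dist_root_map_le {N : ℕ} {A B : Rooted k}
    (e : A.Γ.graph.induce (A.ball N) →g B.Γ.graph.induce (B.ball N))
    (he : ∀ i, e ⟨A.root i, A.root_mem_ball N i⟩ = ⟨B.root i, B.root_mem_ball N i⟩)
    (i : Fin k) (v : A.ball N) (hv : A.Γ.graph.dist (A.root i) v ≤ N) :
    B.Γ.graph.dist (B.root i) (e v) ≤ A.Γ.graph.dist (A.root i) v := by
  have := dist_map_le A.Γ.connected e (r := N) (u := ⟨A.root i, A.root_mem_ball N i⟩) (v := v)
    (fun w hw => ⟨i, hw⟩) hv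
  rwa [he i] at this

/-- An isomorphism of `N`-balls restricts to an isomorphism of the `r`-balls around other roots,
provided that these lie in the `N`-balls. -/
theorem sameBall_of_ball_iso {N r : ℕ} {A B : Rooted k}
    (e : A.Γ.graph.induce (A.ball N) ≃g B.Γ.graph.induce (B.ball N)) (a : Fin l → A.Γ.V)
    (b : Fin l → B.Γ.V) (hA : (Rooted.mk A.Γ a).ball r ⊆ A.ball N)
    (hB : (Rooted.mk B.Γ b).ball r ⊆ B.ball N)
    (hab : ∀ i, e ⟨a i, hA (root_mem_ball r ⟨A.Γ, a⟩ i)⟩ =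
      ⟨b i, hB (root_mem_ball r ⟨B.Γ, b⟩ i)⟩) :
    SameBall r ⟨A.Γ, a⟩ ⟨B.Γ, b⟩ := by
  have hab' : ∀ i, e.symm ⟨b i, hB (root_mem_ball r ⟨B.Γ, b⟩ i)⟩ =
      ⟨a i, hA (root_mem_ball r ⟨A.Γ, a⟩ i)⟩ :=
    fun i => by rw [← hab i]; exact e.symm_apply_apply _
  refine ⟨⟨⟨fun v => ⟨(e ⟨v.1, hA v.2⟩).1, ?_⟩, fun v => ⟨(e.symm ⟨v.1, hB v.2⟩).1, ?_⟩, ?_, ?_⟩,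
    ?_⟩, fun i => ?_⟩
  · obtain ⟨i, hi⟩ := v.2
    have := dist_map_le A.Γ.connected e.toHom (r := r)
      (u := ⟨a i, hA (root_mem_ball r ⟨A.Γ, a⟩ i)⟩) (v := ⟨v.1, hA v.2⟩)
      (fun w hw => hA ⟨i, hw⟩) hi
    have h2 : (e.toHom ⟨a i, hA (root_mem_ball r ⟨A.Γ, a⟩ i)⟩).1 = b i :=
      congrArg Subtype.val (hab i)
    rw [h2] at this
    exact ⟨i, this.trans hi⟩
  · obtain ⟨i, hi⟩ := v.2
    have := dist_map_le B.Γ.connected e.symm.toHom (r := r)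
      (u := ⟨b i, hB (root_mem_ball r ⟨B.Γ, b⟩ i)⟩) (v := ⟨v.1, hB v.2⟩)
      (fun w hw => hB ⟨i, hw⟩) hi
    have h2 : (e.symm.toHom ⟨b i, hB (root_mem_ball r ⟨B.Γ, b⟩ i)⟩).1 = a i :=
      congrArg Subtype.val (hab' i)
    rw [h2] at this
    exact ⟨i, this.trans hi⟩
  · intro v
    refine Subtype.ext ?_
    change (e.symm (e ⟨v.1, hA v.2⟩)).1 = v.1
    rw [e.symm_apply_apply]
  · intro v
    refine Subtype.ext ?_
    change (e (e.symm ⟨v.1, hB v.2⟩)).1 = v.1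
    rw [e.apply_symm_apply]
  · intro u v
    exact e.map_adj_iff (v := ⟨u.1, hA u.2⟩) (w := ⟨v.1, hA v.2⟩)
  · exact Subtype.ext (congrArg Subtype.val (hab i) :)

theorem ball_mono {r s : ℕ} (h : r ≤ s) (A : Rooted k) : A.ball r ⊆ A.ball s :=
  fun _ ⟨i, hi⟩ => ⟨i, hi.trans h⟩

theorem SameBall.mono {r s : ℕ} (hrs : r ≤ s) {A B : Rooted k} (h : A.SameBall s B) :
    A.SameBall r B := by
  obtain ⟨e, he⟩ := h
  exact sameBall_of_ball_iso e A.root B.root (ball_mono hrs A) (ball_mono hrs B) he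

/-- Two graphs with at least one root are isomorphic if all their balls are: this is a form of
König's lemma. The isomorphism is the limit of the isomorphisms of the balls along a
non-principal ultrafilter, which exists since balls are finite. -/
theorem iso_of_forall_sameBall {A B : Rooted (k + 1)} (h : ∀ r, A.SameBall r B) : A.Iso B := by
  choose e he using h
  -- The image of `v` under the isomorphisms of large balls stays in a fixed finite ball, so it is
  -- constant along the ultrafilter. This is used for the isomorphisms and for their inverses.
  let U : Ultrafilter ℕ := Filter.hyperfilter ℕ
  have hU : (U : Filter ℕ) ≤ Filter.atTop := by
    rw [← Nat.cofinite_eq_atTop]; exact Filter.hyperfilter_le_cofinite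
  have lim : ∀ {A B : Rooted (k + 1)}
      (e : ∀ r, A.Γ.graph.induce (A.ball r) ≃g B.Γ.graph.induce (B.ball r))
      (_ : ∀ r i, e r ⟨A.root i, A.root_mem_ball r i⟩ = ⟨B.root i, B.root_mem_ball r i⟩)
      (v : A.Γ.V), ∃ w : B.Γ.V, ∀ᶠ r in U, ∃ h : v ∈ A.ball r, (e r ⟨v, h⟩).1 = w := by
    intro A B e he v
    have hev : ∀ᶠ r in (U : Filter ℕ), ∃ w ∈ B.ball (A.Γ.graph.dist (A.root 0) v),
        ∃ h : v ∈ A.ball r, (e r ⟨v, h⟩).1 = w := by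
      filter_upwards [hU (Filter.eventually_ge_atTop (A.Γ.graph.dist (A.root 0) v))] with r hr
      exact ⟨_, ⟨0, dist_root_map_le (e r).toHom (he r) 0 ⟨v, 0, hr⟩ hr⟩, ⟨0, hr⟩, rfl⟩
    have := (Ultrafilter.eventually_exists_mem_iff (B.finite_ball _)).1 hev
    obtain ⟨w, -, hw⟩ := this
    exact ⟨w, hw⟩
  choose f hf using lim e he
  choose g hg using lim (fun r => (e r).symm)
    (fun r i => by rw [← he r i]; exact (e r).symm_apply_apply _)
  have hgf : ∀ v, g (f v) = v := by
    intro v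
    obtain ⟨r, ⟨h1, h1'⟩, h2, h2'⟩ := ((hf v).and (hg (f v))).exists
    have h3 : (⟨f v, h2⟩ : B.ball r) = e r ⟨v, h1⟩ := Subtype.ext h1'.symm
    rw [h3, (e r).symm_apply_apply] at h2'
    exact h2'.symm
  have hfg : ∀ w, f (g w) = w := by
    intro w
    obtain ⟨r, ⟨h1, h1'⟩, h2, h2'⟩ := ((hg w).and (hf (g w))).exists
    have h3 : (⟨g w, h2⟩ : A.ball r) = (e r).symm ⟨w, h1⟩ := Subtype.ext h1'.symm
    rw [h3, (e r).apply_symm_apply] at h2'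
    exact h2'.symm
  refine ⟨⟨⟨f, g, hgf, hfg⟩, ?_⟩, fun i => ?_⟩
  · intro u v
    obtain ⟨r, ⟨h1, h1'⟩, h2, h2'⟩ := ((hf u).and (hf v)).exists
    change B.Γ.graph.Adj (f u) (f v) ↔ _
    rw [← h1', ← h2']
    exact (e r).map_adj_iff (v := ⟨u, h1⟩) (w := ⟨v, h2⟩)
  · obtain ⟨r, h1, h1'⟩ := (hf (A.root i)).exists
    change f (A.root i) = _
    rw [← h1']
    exact congrArg Subtype.val (he r i)

end Rooted

/-! ### The topology of the space of rooted graphs -/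

namespace Gr

variable {k : ℕ}

theorem mk_eq_mk {A B : Rooted k} : mk A = mk B ↔ A.Iso B :=
  ⟨fun h => Quotient.exact h, fun h => Quotient.sound h⟩

theorem mk_mem_cylinder {r : ℕ} {A B : Rooted k} : mk B ∈ cylinder r A ↔ A.SameBall r B := by
  constructor
  · rintro ⟨C, hC, h⟩
    exact h.trans ((mk_eq_mk.1 hC).sameBall r)
  · exact fun h => ⟨B, rfl, h⟩

theorem exists_mk (ξ : Gr k) : ∃ A, mk A = ξ := Quotient.exists_rep ξ

theorem isOpen_cylinder (r : ℕ) (A : Rooted k) : IsOpen (cylinder r A) :=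
  TopologicalSpace.isOpen_generateFrom_of_mem ⟨r, A, rfl⟩

/-- A set of rooted graphs is `r`-determined if membership depends only on the `r`-balls around
the roots. -/
def IsDetermined (r : ℕ) (C : Set (Gr k)) : Prop :=
  ∀ A B : Rooted k, A.SameBall r B → mk A ∈ C → mk B ∈ C

theorem IsDetermined.isOpen {r : ℕ} {C : Set (Gr k)} (hC : IsDetermined r C) : IsOpen C := by
  refine isOpen_iff_forall_mem_open.2 fun ξ hξ => ?_
  obtain ⟨A, rfl⟩ := exists_mk ξ
  refine ⟨cylinder r A, ?_, isOpen_cylinder r A, mk_mem_cylinder.2 ((Rooted.Iso.refl A).sameBall r)⟩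
  rintro _ ⟨B, rfl, hB⟩
  exact hC A B hB hξ

theorem isDetermined_univ (r : ℕ) : IsDetermined r (Set.univ : Set (Gr k)) :=
  fun _ _ _ _ => trivial

theorem isDetermined_cylinder (r : ℕ) (A : Rooted k) : IsDetermined r (cylinder r A) := by
  intro B C h hB
  rw [mk_mem_cylinder] at hB ⊢
  exact hB.trans h

theorem measurable_of_isDetermined {X : Type*} [MeasurableSpace X] {f : Gr k → X} (r : ℕ)
    (hf : ∀ A B : Rooted k, A.SameBall r B → f (mk A) = f (mk B)) : Measurable f := by
  intro s _
  refine IsOpen.measurableSet (IsDetermined.isOpen (r := r) fun A B h hA => ?_)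
  rwa [Set.mem_preimage, ← hf A B h]

theorem isPiSystem_cylinder :
    IsPiSystem {U : Set (Gr k) | ∃ (r : ℕ) (A : Rooted k), U = cylinder r A} := by
  rintro _ ⟨r, A, rfl⟩ _ ⟨s, B, rfl⟩ ⟨ξ, hA, hB⟩
  obtain ⟨C, rfl⟩ := exists_mk ξ
  rw [mk_mem_cylinder] at hA hB
  refine ⟨max r s, C, ?_⟩
  ext η
  obtain ⟨D, rfl⟩ := exists_mk η
  simp only [Set.mem_inter_iff, mk_mem_cylinder]
  constructor
  · rintro ⟨h1, h2⟩
    rcases le_total r s with h | h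
    · rw [max_eq_right h]; exact hB.symm.trans h2
    · rw [max_eq_left h]; exact hA.symm.trans h1
  · intro h
    exact ⟨hA.trans (h.mono (le_max_left _ _)), hB.trans (h.mono (le_max_right _ _))⟩

/-- There are countably many cylinders, since a cylinder is given by a radius and a finite graph
with roots. -/
theorem countable_cylinders :
    {U : Set (Gr k) | ∃ (r : ℕ) (A : Rooted k), U = cylinder r A}.Countable := by
  let F : (ℕ × Σ n : ℕ, SimpleGraph (Fin n) × (Fin k → Fin n)) → Set (Gr k) := fun c =>
    {ξ | ∃ B : Rooted k, mk B = ξ ∧ ∃ e : B.Γ.graph.induce (B.ball c.1) ≃g c.2.2.1,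
      ∀ i, e ⟨B.root i, B.root_mem_ball c.1 i⟩ = c.2.2.2 i}
  refine (Set.countable_range F).mono ?_
  rintro _ ⟨r, A, rfl⟩
  have := (A.finite_ball r).to_subtype
  obtain ⟨n, ⟨f⟩⟩ := Finite.exists_equiv_fin (A.ball r)
  let H := (A.Γ.graph.induce (A.ball r)).map f.toEmbedding
  let e₀ : A.Γ.graph.induce (A.ball r) ≃g H := SimpleGraph.Iso.map f _
  refine ⟨(r, ⟨n, H, fun i => e₀ ⟨A.root i, A.root_mem_ball r i⟩⟩), ?_⟩
  ext ξ
  constructor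
  · rintro ⟨B, rfl, e, he⟩
    refine ⟨B, rfl, e₀.trans e.symm, fun i => ?_⟩
    exact (congrArg e.symm (he i).symm).trans (e.symm_apply_apply _)
  · rintro ⟨B, rfl, e, he⟩
    refine ⟨B, rfl, e.symm.trans e₀, fun i => ?_⟩
    change e₀ (e.symm _) = _
    rw [← he i, e.symm_apply_apply]

instance : SecondCountableTopology (Gr k) :=
  ⟨⟨_, countable_cylinders, rfl⟩⟩

instance : T2Space (Gr (k + 1)) := by
  refine ⟨fun ξ η hne => ?_⟩
  obtain ⟨A, rfl⟩ := exists_mk ξ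
  obtain ⟨B, rfl⟩ := exists_mk η
  obtain ⟨r, hr⟩ : ∃ r, ¬ A.SameBall r B := by
    by_contra! h
    exact hne (mk_eq_mk.2 (Rooted.iso_of_forall_sameBall h))
  refine ⟨_, _, isOpen_cylinder r A, isOpen_cylinder r B,
    mk_mem_cylinder.2 ((Rooted.Iso.refl A).sameBall r),
    mk_mem_cylinder.2 ((Rooted.Iso.refl B).sameBall r), Set.disjoint_left.2 fun ζ h1 h2 => ?_⟩
  obtain ⟨C, rfl⟩ := exists_mk ζ
  exact hr ((mk_mem_cylinder.1 h1).trans (mk_mem_cylinder.1 h2).symm)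

theorem generateFrom_cylinder : (inferInstance : MeasurableSpace (Gr k)) =
    MeasurableSpace.generateFrom {U | ∃ (r : ℕ) (A : Rooted k), U = cylinder r A} :=
  borel_eq_generateFrom_of_subbasis rfl

end Gr

/-! ### The distance between the two roots -/

theorem dist_le_of_sameBall {r : ℕ} {A B : Rooted 2} (h : A.SameBall r B)
    (hA : A.Γ.graph.dist (A.root 0) (A.root 1) ≤ r) :
    B.Γ.graph.dist (B.root 0) (B.root 1) ≤ A.Γ.graph.dist (A.root 0) (A.root 1) := by
  obtain ⟨e, he⟩ := h
  have h1 := Rooted.dist_root_map_le e.toHom he 0 ⟨A.root 1, A.root_mem_ball r 1⟩ hA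
  have h2 : (e.toHom ⟨A.root 1, A.root_mem_ball r 1⟩).1 = B.root 1 := congrArg Subtype.val (he 1)
  rwa [h2] at h1

theorem dist_eq_of_sameBall {r : ℕ} {A B : Rooted 2} (h : A.SameBall r B)
    (hA : A.Γ.graph.dist (A.root 0) (A.root 1) ≤ r) :
    A.Γ.graph.dist (A.root 0) (A.root 1) = B.Γ.graph.dist (B.root 0) (B.root 1) :=
  have h1 := dist_le_of_sameBall h hA
  (dist_le_of_sameBall h.symm (h1.trans hA)).antisymm h1

/-- The distance between the two roots. -/
def rootDist : Gr₂ → ℕ :=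
  Quotient.lift (fun A => A.Γ.graph.dist (A.root 0) (A.root 1)) fun _ _ h =>
    dist_eq_of_sameBall (Rooted.Iso.sameBall h _) le_rfl

theorem isDetermined_rootDist (n : ℕ) : Gr.IsDetermined n (rootDist ⁻¹' {n}) := by
  intro A B h hA
  have hA' : A.Γ.graph.dist (A.root 0) (A.root 1) = n := hA
  exact (dist_eq_of_sameBall h hA'.le).symm.trans hA'

theorem measurableSet_rootDist (n : ℕ) : MeasurableSet (rootDist ⁻¹' {n}) :=
  (isDetermined_rootDist n).isOpen.measurableSet

theorem measurable_rootDist : Measurable rootDist :=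
  measurable_to_countable' measurableSet_rootDist

/-! ### The fibers of the projection to the primary root -/

theorem cls₁_eq_cls₁ {Γ Γ' : LFGraph} {x : Γ.V} {x' : Γ'.V} :
    cls₁ Γ x = cls₁ Γ' x' ↔ ∃ e : Γ.graph ≃g Γ'.graph, e x = x' := by
  refine Gr.mk_eq_mk.trans (exists_congr fun e => ?_)
  exact ⟨fun h => h 0, fun h i => by fin_cases i; exact h⟩

theorem cls₂_eq_cls₂ {Γ Γ' : LFGraph} {x y : Γ.V} {x' y' : Γ'.V} :
    cls₂ Γ x y = cls₂ Γ' x' y' ↔ ∃ e : Γ.graph ≃g Γ'.graph, e x = x' ∧ e y = y' := by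
  refine Gr.mk_eq_mk.trans (exists_congr fun e => ?_)
  exact ⟨fun h => ⟨h 0, h 1⟩, fun h i => by fin_cases i; exacts [h.1, h.2]⟩

theorem exists_cls₁ (ξ : Gr₁) : ∃ (Γ : LFGraph) (x : Γ.V), ξ = cls₁ Γ x := by
  obtain ⟨A, rfl⟩ := Gr.exists_mk ξ
  refine ⟨A.Γ, A.root 0, congrArg (fun a => Gr.mk ⟨A.Γ, a⟩) ?_⟩
  funext j; fin_cases j; rfl

theorem exists_eq_cls₂_of_primary {Γ : LFGraph} {x : Γ.V} {θ : Gr₂} (h : primary θ = cls₁ Γ x) :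
    ∃ y, cls₂ Γ x y = θ := by
  obtain ⟨Γ', x', y', rfl⟩ := exists_cls₂ θ
  rw [primary_cls₂] at h
  obtain ⟨e, he⟩ := cls₁_eq_cls₁.1 h
  exact ⟨e y', (cls₂_eq_cls₂.2 ⟨e, he, rfl⟩).symm⟩

theorem stabOrbit_eq (Γ : LFGraph) (x y : Γ.V) :
    stabOrbit Γ x y = {z | cls₂ Γ x z = cls₂ Γ x y} := by
  ext z
  exact cls₂_eq_cls₂.symm.trans eq_comm

theorem finite_dist_eq (Γ : LFGraph) (n : ℕ) (x : Γ.V) : {v | Γ.graph.dist x v = n}.Finite :=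
  (finite_dist_le Γ n x).subset fun _ hv => le_of_eq hv

theorem rootDist_cls₂ (Γ : LFGraph) (x y : Γ.V) : rootDist (cls₂ Γ x y) = Γ.graph.dist x y := rfl

theorem finite_stabOrbit (Γ : LFGraph) (x y : Γ.V) : (stabOrbit Γ x y).Finite := by
  refine (finite_dist_eq Γ (Γ.graph.dist x y) x).subset fun z hz => ?_
  rw [stabOrbit_eq] at hz
  exact congrArg rootDist hz

theorem orbitWeight_ne_top (θ : Gr₂) : orbitWeight θ ≠ ∞ := by
  obtain ⟨Γ, x, y, rfl⟩ := exists_cls₂ θ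
  change (((stabOrbit Γ x y).encard : ℕ∞) : ℝ≥0∞) ≠ ∞
  simpa using (finite_stabOrbit Γ x y)

theorem orbitWeight_ne_zero (θ : Gr₂) : orbitWeight θ ≠ 0 := by
  obtain ⟨Γ, x, y, rfl⟩ := exists_cls₂ θ
  change (((stabOrbit Γ x y).encard : ℕ∞) : ℝ≥0∞) ≠ 0
  have : y ∈ stabOrbit Γ x y := by rw [stabOrbit_eq]; rfl
  simpa using Set.nonempty_iff_ne_empty.1 ⟨y, this⟩

theorem tsum_fiberwise {α β : Type*} (g : α → β) (F : α → ℝ≥0∞) :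
    ∑' a, F a = ∑' b, ∑' a : {a // g a = b}, F a := by
  rw [← (Equiv.sigmaFiberEquiv g).tsum_eq, ENNReal.tsum_sigma']
  rfl

theorem lintegral_fiberWeight {f : Gr₂ → ℝ≥0∞} (hf : Measurable f) (ξ : Gr₁) :
    ∫⁻ θ, f θ ∂fiberWeight ξ = ∑' θ : {θ : Gr₂ // primary θ = ξ}, orbitWeight θ * f θ := by
  rw [fiberWeight, lintegral_sum_measure]
  refine tsum_congr fun θ => ?_
  rw [lintegral_smul_measure, lintegral_dirac' _ hf, smul_eq_mul]

/-- The measure `fiberWeight` on the fiber over the class of `(Γ, x)` is the image of the counting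
measure on the vertices of `Γ`: the orbits of the stabilizer of `x` correspond to the points of
the fiber. -/
theorem lintegral_fiberWeight_cls₁ {f : Gr₂ → ℝ≥0∞} (hf : Measurable f) (Γ : LFGraph) (x : Γ.V) :
    ∫⁻ θ, f θ ∂fiberWeight (cls₁ Γ x) = ∑' y, f (cls₂ Γ x y) := by
  rw [lintegral_fiberWeight hf, tsum_fiberwise fun y =>
    (⟨cls₂ Γ x y, primary_cls₂ Γ x y⟩ : {θ : Gr₂ // primary θ = cls₁ Γ x})]
  refine tsum_congr fun θ => ?_
  obtain ⟨θ, hθ⟩ := θ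
  obtain ⟨y, rfl⟩ := exists_eq_cls₂_of_primary hθ
  have h1 : ∀ z : {z // (⟨cls₂ Γ x z, primary_cls₂ Γ x z⟩ : {θ : Gr₂ // primary θ = cls₁ Γ x}) =
      ⟨cls₂ Γ x y, hθ⟩}, f (cls₂ Γ x z) = f (cls₂ Γ x y) :=
    fun z => congrArg f (congrArg Subtype.val z.2)
  rw [tsum_congr h1]
  refine Eq.trans ?_ (ENNReal.tsum_set_const {z | (⟨cls₂ Γ x z, primary_cls₂ Γ x z⟩ :
    {θ : Gr₂ // primary θ = cls₁ Γ x}) = ⟨cls₂ Γ x y, hθ⟩} _).symm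
  have h2 : {z | (⟨cls₂ Γ x z, primary_cls₂ Γ x z⟩ :
      {θ : Gr₂ // primary θ = cls₁ Γ x}) = ⟨cls₂ Γ x y, hθ⟩} = stabOrbit Γ x y := by
    rw [stabOrbit_eq]
    ext z
    exact Subtype.ext_iff
  rw [h2]
  rfl

theorem fiberWeight_cls₁ {C : Set Gr₂} (hC : MeasurableSet C) (Γ : LFGraph) (x : Γ.V) :
    fiberWeight (cls₁ Γ x) C = ({y | cls₂ Γ x y ∈ C}.encard : ℝ≥0∞) := by
  rw [← lintegral_indicator_one hC, lintegral_fiberWeight_cls₁ (measurable_one.indicator hC),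
    ← ENNReal.tsum_set_one, tsum_subtype _ fun _ => (1 : ℝ≥0∞)]
  rfl

theorem ae_primary_eq (ξ : Gr₁) : ∀ᵐ θ ∂fiberWeight ξ, primary θ = ξ := by
  have hm : MeasurableSet {θ | ¬ primary θ = ξ} :=
    (measurableSet_eq_fun measurable_primary measurable_const).compl
  rw [ae_iff, ← lintegral_indicator_one hm, lintegral_fiberWeight (measurable_one.indicator hm)]
  refine ENNReal.tsum_eq_zero.2 fun θ => ?_
  simp [Set.indicator, θ.2]

/-! ### Local constancy of the weighted fiber measures -/

theorem ball_pair_subset {Γ : LFGraph} {x y : Γ.V} {n : ℕ} (hn : Γ.graph.dist x y = n) (r : ℕ) :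
    (Rooted.mk Γ ![x, y]).ball r ⊆ (Rooted.mk Γ ![x]).ball (r + n) := by
  rintro v ⟨i, hi⟩
  refine ⟨0, ?_⟩
  fin_cases i
  · exact le_add_right hi
  · have h1 := Γ.connected.dist_triangle (u := x) (v := y) (w := v)
    have h2 : Γ.graph.dist y v ≤ r := hi
    change Γ.graph.dist x v ≤ _
    omega

theorem encard_le_of_sameBall {Γ Γ' : LFGraph} {x : Γ.V} {x' : Γ'.V} {r n : ℕ}
    (h : Rooted.SameBall (r + n) ⟨Γ, ![x]⟩ ⟨Γ', ![x']⟩) {C : Set Gr₂} (hC : Gr.IsDetermined r C) :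
    {y | cls₂ Γ x y ∈ rootDist ⁻¹' {n} ∩ C}.encard ≤
      {y | cls₂ Γ' x' y ∈ rootDist ⁻¹' {n} ∩ C}.encard := by
  obtain ⟨e, he⟩ := h
  have hmem : ∀ y, Γ.graph.dist x y = n → y ∈ (Rooted.mk Γ ![x]).ball (r + n) :=
    fun y hy => ball_pair_subset hy r (Rooted.root_mem_ball r ⟨Γ, ![x, y]⟩ 1)
  have hdist : ∀ y (hy : Γ.graph.dist x y = n), Γ'.graph.dist x' (e ⟨y, hmem y hy⟩).1 = n := by
    intro y hy
    have h1 := Rooted.dist_root_map_le e.toHom he 0 ⟨y, hmem y hy⟩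
      (show Γ.graph.dist x y ≤ _ by omega)
    have h1' : Γ'.graph.dist x' (e ⟨y, hmem y hy⟩).1 ≤ Γ.graph.dist x y := h1
    have h2 := Rooted.dist_root_map_le e.symm.toHom
      (fun i => by rw [← he i]; exact e.symm_apply_apply _) 0 (e ⟨y, hmem y hy⟩)
      (show Γ'.graph.dist x' (e ⟨y, hmem y hy⟩).1 ≤ _ by omega)
    have h3 : e.symm.toHom (e ⟨y, hmem y hy⟩) = ⟨y, hmem y hy⟩ := e.symm_apply_apply _
    rw [h3] at h2
    have h2' : Γ.graph.dist x y ≤ Γ'.graph.dist x' (e ⟨y, hmem y hy⟩).1 := h2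
    omega
  refine Function.Embedding.encard_le ⟨fun y => ⟨(e ⟨y.1, hmem y.1 y.2.1⟩).1, hdist _ y.2.1, ?_⟩,
    fun y z hyz => ?_⟩
  · refine hC _ _ ?_ y.2.2
    refine Rooted.sameBall_of_ball_iso e ![x, y.1] ![x', _] (ball_pair_subset y.2.1 r)
      (ball_pair_subset (hdist _ y.2.1) r) fun i => ?_
    fin_cases i
    · exact he 0
    · rfl
  · have h1 := e.injective (Subtype.ext (congrArg Subtype.val hyz :))
    have h2 : y.1 = z.1 := Subtype.mk.inj h1
    exact Subtype.ext h2

/-- The mass of an `r`-determined set at distance `n` between the roots depends only on the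
`(r + n)`-ball around the primary root. -/
theorem measurable_fiberWeight_of_isDetermined (n : ℕ) {r : ℕ} {C : Set Gr₂}
    (hC : Gr.IsDetermined r C) : Measurable fun ξ => fiberWeight ξ (rootDist ⁻¹' {n} ∩ C) := by
  have hm : MeasurableSet (rootDist ⁻¹' {n} ∩ C) :=
    (measurableSet_rootDist n).inter hC.isOpen.measurableSet
  refine Gr.measurable_of_isDetermined (r + n) ?_
  rintro ⟨Γ, a⟩ ⟨Γ', a'⟩ h
  obtain ⟨x, rfl⟩ : ∃ x, a = ![x] := ⟨a 0, by funext j; fin_cases j; rfl⟩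
  obtain ⟨x', rfl⟩ : ∃ x, a' = ![x] := ⟨a' 0, by funext j; fin_cases j; rfl⟩
  refine ((fiberWeight_cls₁ hm Γ x).trans ?_).trans (fiberWeight_cls₁ hm Γ' x').symm
  rw [(encard_le_of_sameBall h hC).antisymm (encard_le_of_sameBall h.symm hC)]

/-! ### Measurability of the weighted fiber measures -/

/-- The number of vertices at distance `n` from the root. -/
def sphereCard (n : ℕ) (ξ : Gr₁) : ℝ≥0∞ := fiberWeight ξ (rootDist ⁻¹' {n})

theorem measurable_sphereCard (n : ℕ) : Measurable (sphereCard n) := by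
  have h := measurable_fiberWeight_of_isDetermined n (Gr.isDetermined_univ 0)
  simp_rw [Set.inter_univ] at h
  exact h

theorem sphereCard_cls₁ (n : ℕ) (Γ : LFGraph) (x : Γ.V) :
    sphereCard n (cls₁ Γ x) = ({y | Γ.graph.dist x y = n}.encard : ℝ≥0∞) :=
  fiberWeight_cls₁ (measurableSet_rootDist n) Γ x

theorem sphereCard_ne_top (n : ℕ) (ξ : Gr₁) : sphereCard n ξ ≠ ∞ := by
  obtain ⟨Γ, x, rfl⟩ := exists_cls₁ ξ
  rw [sphereCard_cls₁]
  simpa using finite_dist_eq Γ n x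

theorem sphereCard_ne_zero (θ : Gr₂) : sphereCard (rootDist θ) (primary θ) ≠ 0 := by
  obtain ⟨Γ, x, y, rfl⟩ := exists_cls₂ θ
  rw [primary_cls₂, sphereCard_cls₁, rootDist_cls₂]
  have : y ∈ {z | Γ.graph.dist x z = Γ.graph.dist x y} := rfl
  simpa using Set.nonempty_iff_ne_empty.1 ⟨y, this⟩

theorem measurable_sphereCard_rootDist :
    Measurable fun θ => sphereCard (rootDist θ) (primary θ) := by
  have h : Measurable fun p : ℕ × Gr₁ => sphereCard p.1 p.2 :=
    measurable_from_prod_countable_right measurable_sphereCard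
  have h1 := h.comp (measurable_rootDist.prodMk measurable_primary)
  exact h1

/-- A positive function on doubly rooted graphs whose integrals over the fibers of the projection
to the primary root are bounded. -/
def tameWeight (θ : Gr₂) : ℝ≥0∞ := (2 ^ rootDist θ * sphereCard (rootDist θ) (primary θ))⁻¹

theorem measurable_tameWeight : Measurable tameWeight := by
  have h2 : Measurable fun θ => (2 : ℝ≥0∞) ^ rootDist θ :=
    measurable_from_nat.comp measurable_rootDist
  exact (h2.mul measurable_sphereCard_rootDist).inv

theorem tameWeight_ne_zero (θ : Gr₂) : tameWeight θ ≠ 0 :=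
  ENNReal.inv_ne_zero.2 (ENNReal.mul_ne_top (by simp) (sphereCard_ne_top _ _))

theorem tameWeight_ne_top (θ : Gr₂) : tameWeight θ ≠ ∞ :=
  ENNReal.inv_ne_top.2 (mul_ne_zero (by simp) (sphereCard_ne_zero θ))

theorem setLIntegral_tameWeight (ξ : Gr₁) {C : Set Gr₂} (hC : MeasurableSet C) :
    ∫⁻ θ in C, tameWeight θ ∂fiberWeight ξ =
      ∑' n : ℕ, (2 ^ n * sphereCard n ξ)⁻¹ * fiberWeight ξ (rootDist ⁻¹' {n} ∩ C) := by
  -- Decompose according to the distance between the roots.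
  have hU : C = ⋃ n, rootDist ⁻¹' {n} ∩ C := by
    ext θ; simp
  have hm : ∀ n, MeasurableSet (rootDist ⁻¹' {n} ∩ C) :=
    fun n => (measurableSet_rootDist n).inter hC
  conv_lhs => rw [hU]
  rw [lintegral_iUnion hm]
  · refine tsum_congr fun n => ?_
    rw [← setLIntegral_const]
    refine setLIntegral_congr_fun_ae (hm n) ?_
    filter_upwards [ae_primary_eq ξ] with θ hθ hn
    rw [tameWeight, hθ, show rootDist θ = n from hn.1]
  · intro m n hmn
    refine Set.disjoint_left.2 fun θ h1 h2 => hmn ?_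
    exact (show rootDist θ = m from h1.1).symm.trans h2.1

theorem lintegral_tameWeight_le (ξ : Gr₁) : ∫⁻ θ, tameWeight θ ∂fiberWeight ξ ≤ 2 := by
  rw [← setLIntegral_univ, setLIntegral_tameWeight ξ MeasurableSet.univ]
  calc ∑' n : ℕ, (2 ^ n * sphereCard n ξ)⁻¹ * fiberWeight ξ (rootDist ⁻¹' {n} ∩ Set.univ)
      ≤ ∑' n : ℕ, (2⁻¹ : ℝ≥0∞) ^ n := by
        refine ENNReal.tsum_le_tsum fun n => ?_
        rw [Set.inter_univ, ENNReal.mul_inv (Or.inl (by simp)) (Or.inl (by simp)), mul_assoc,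
          ENNReal.inv_pow]
        exact mul_le_of_le_one_right' (ENNReal.inv_mul_le_one _)
    _ = 2 := by
        rw [ENNReal.tsum_geometric, ENNReal.one_sub_inv_two, inv_inv]

theorem isFiniteMeasure_tame (ξ : Gr₁) : IsFiniteMeasure ((fiberWeight ξ).withDensity tameWeight) :=
  isFiniteMeasure_withDensity ((lintegral_tameWeight_le ξ).trans_lt (by simp)).ne

theorem measurable_withDensity_tameWeight :
    Measurable fun ξ => (fiberWeight ξ).withDensity tameWeight := by
  have key : ∀ (r : ℕ) (C : Set Gr₂), Gr.IsDetermined r C →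
      Measurable fun ξ => (fiberWeight ξ).withDensity tameWeight C := by
    intro r C hC
    simp_rw [withDensity_apply _ hC.isOpen.measurableSet,
      setLIntegral_tameWeight _ hC.isOpen.measurableSet]
    exact Measurable.tsum fun n => ((measurable_sphereCard n).const_mul _).inv.mul
      (measurable_fiberWeight_of_isDetermined n hC)
  have := isFiniteMeasure_tame
  refine Measurable.measure_of_isPiSystem Gr.generateFrom_cylinder Gr.isPiSystem_cylinder ?_
    (key 0 _ (Gr.isDetermined_univ 0))
  rintro _ ⟨r, A, rfl⟩
  exact key r _ (Gr.isDetermined_cylinder r A)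

/-- The weighted fiber measures with density `tameWeight`, as a kernel. -/
def tameKernel : ProbabilityTheory.Kernel Gr₁ Gr₂ :=
  ⟨fun ξ => (fiberWeight ξ).withDensity tameWeight, measurable_withDensity_tameWeight⟩

instance : ProbabilityTheory.IsFiniteKernel tameKernel :=
  ⟨2, by simp, fun ξ => by
    change (fiberWeight ξ).withDensity tameWeight Set.univ ≤ 2
    rw [withDensity_apply _ MeasurableSet.univ, setLIntegral_univ]
    exact lintegral_tameWeight_le ξ⟩

/-- The weighted fiber measures, as a kernel. -/
def weightKernel : ProbabilityTheory.Kernel Gr₁ Gr₂ :=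
  tameKernel.withDensity fun _ θ => (tameWeight θ)⁻¹

instance : ProbabilityTheory.IsSFiniteKernel weightKernel :=
  ProbabilityTheory.Kernel.IsSFiniteKernel.withDensity _
    fun _ θ => ENNReal.inv_ne_top.2 (tameWeight_ne_zero θ)

theorem weightKernel_apply (ξ : Gr₁) : weightKernel ξ = fiberWeight ξ := by
  have hm : Measurable (Function.uncurry fun (_ : Gr₁) (θ : Gr₂) => (tameWeight θ)⁻¹) :=
    measurable_tameWeight.inv.comp measurable_snd
  rw [weightKernel, ProbabilityTheory.Kernel.withDensity_apply _ hm]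
  exact withDensity_inv_same measurable_tameWeight (Filter.Eventually.of_forall tameWeight_ne_zero)
    (Filter.Eventually.of_forall tameWeight_ne_top)

theorem measurable_fiberWeight : Measurable fiberWeight := by
  rw [← funext weightKernel_apply]
  exact weightKernel.measurable

theorem measurable_lintegral_fiberWeight {X : Type*} [MeasurableSpace X] {g : X → Gr₁}
    (hg : Measurable g) {F : X → Gr₂ → ℝ≥0∞} (hF : Measurable (Function.uncurry F)) :
    Measurable fun a => ∫⁻ θ, F a θ ∂fiberWeight (g a) := by
  simp_rw [← weightKernel_apply]
  exact hF.lintegral_kernel_prod_right (κ := weightKernel.comap g hg)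

/-- The weight of an atom is recovered by integrating over the diagonal. -/
theorem measurable_orbitWeight : Measurable orbitWeight := by
  classical
  have hm : Measurable (Function.uncurry fun θ θ' : Gr₂ => if θ' = θ then (1 : ℝ≥0∞) else 0) :=
    Measurable.ite (measurableSet_eq_fun measurable_snd measurable_fst) measurable_const
      measurable_const
  have h := measurable_lintegral_fiberWeight measurable_primary hm
  convert h using 1
  funext θ
  rw [lintegral_fiberWeight (f := fun θ' => if θ' = θ then (1 : ℝ≥0∞) else 0)
    (hm.comp measurable_prodMk_left), tsum_eq_single ⟨θ, rfl⟩]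
  · simp
  · intro θ' hne
    have : (θ' : Gr₂) ≠ θ := fun h => hne (Subtype.ext h)
    simp [this]

/-! ### Sums over the fibers of `rootPair` -/

/-- The sum of a function over a fiber of the map `rootPair`. -/
def fiberSum (h : Gr₂ → ℝ≥0∞) (p : rootMoving) : ℝ≥0∞ := ∑' θ : {θ // rootPair θ = p}, h θ

instance : MeasurableEq rootMoving := by
  refine ⟨?_⟩
  have h : Set.diagonal rootMoving =
      {p | p.1.1.1 = p.2.1.1} ∩ {p | p.1.1.2 = p.2.1.2} := by
    ext ⟨p, q⟩
    exact Subtype.ext_iff.trans Prod.ext_iff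
  rw [h]
  have h1 : Measurable fun p : rootMoving × rootMoving => p.1.1 :=
    measurable_subtype_coe.comp measurable_fst
  have h2 : Measurable fun p : rootMoving × rootMoving => p.2.1 :=
    measurable_subtype_coe.comp measurable_snd
  exact (measurableSet_eq_fun h1.fst h2.fst).inter (measurableSet_eq_fun h1.snd h2.snd)

theorem tsum_primary_fiber (F : Gr₂ → ℝ≥0∞) (ξ : Gr₁) :
    ∑' θ : {θ : Gr₂ // primary θ = ξ}, F θ =
      ∑' p : {p : rootMoving // p.1.1 = ξ}, fiberSum F p := by
  rw [tsum_fiberwise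
    (fun θ : {θ : Gr₂ // primary θ = ξ} =>
      (⟨rootPair θ.1, θ.2⟩ : {p : rootMoving // p.1.1 = ξ})) fun θ => F θ.1]
  refine tsum_congr fun p => ?_
  let e : {θ : {θ : Gr₂ // primary θ = ξ} //
      (⟨rootPair θ.1, θ.2⟩ : {p : rootMoving // p.1.1 = ξ}) = p} ≃ {θ // rootPair θ = p.1} :=
    { toFun := fun θ => ⟨θ.1.1, congrArg Subtype.val θ.2⟩
      invFun := fun θ =>
        ⟨⟨θ.1, (congrArg (fun q : rootMoving => q.1.1) θ.2).trans p.2⟩, Subtype.ext θ.2⟩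
      left_inv := fun _ => rfl
      right_inv := fun _ => rfl }
  exact e.tsum_eq fun θ : {θ // rootPair θ = p.1} => F θ

/-- The fiber of `rootPair` over `p` is a measurable part of the fiber over the first component
of `p`, so the sum is an integral against `fiberWeight`, after division by the atoms' masses. -/
theorem measurable_fiberSum {h : Gr₂ → ℝ≥0∞} (hh : Measurable h) : Measurable (fiberSum h) := by
  classical
  have hm : Measurable (Function.uncurry fun (p : rootMoving) (θ : Gr₂) =>
      if rootPair θ = p then h θ / orbitWeight θ else 0) :=
    Measurable.ite (measurableSet_eq_fun (measurable_rootPair.comp measurable_snd) measurable_fst)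
      ((hh.div measurable_orbitWeight).comp measurable_snd) measurable_const
  have h1 := measurable_lintegral_fiberWeight
    (measurable_fst.comp measurable_subtype_coe : Measurable fun p : rootMoving => p.1.1) hm
  convert h1 using 1
  funext p
  rw [lintegral_fiberWeight (f := fun θ => if rootPair θ = p then h θ / orbitWeight θ else 0)
    (hm.comp measurable_prodMk_left),
    tsum_primary_fiber fun θ => orbitWeight θ * if rootPair θ = p then h θ / orbitWeight θ else 0,
    tsum_eq_single ⟨p, rfl⟩]
  · refine tsum_congr fun θ => ?_
    beta_reduce
    rw [if_pos θ.2, ENNReal.mul_div_cancel (orbitWeight_ne_zero _) (orbitWeight_ne_top _)]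
  · intro q hq
    refine ENNReal.tsum_eq_zero.2 fun θ => ?_
    beta_reduce
    rw [if_neg fun h => hq (Subtype.ext (θ.2.symm.trans h)), mul_zero]

theorem fiberSum_mul_comp (h : Gr₂ → ℝ≥0∞) (g : rootMoving → ℝ≥0∞) (p : rootMoving) :
    fiberSum (fun θ => h θ * g (rootPair θ)) p = fiberSum h p * g p := by
  rw [fiberSum, fiberSum, ← ENNReal.tsum_mul_right]
  exact tsum_congr fun θ => by rw [θ.2]

theorem lintegral_fiberCount {f : rootMoving → ℝ≥0∞} (hf : Measurable f) (ξ : Gr₁) :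
    ∫⁻ p, f p ∂fiberCount ξ = ∑' p : {p : rootMoving // p.1.1 = ξ}, f p := by
  rw [fiberCount, lintegral_sum_measure]
  exact tsum_congr fun p => lintegral_dirac' _ hf

theorem lintegral_fiberWeight_eq_fiberCount {h : Gr₂ → ℝ≥0∞} (hh : Measurable h) (ξ : Gr₁) :
    ∫⁻ θ, h θ ∂fiberWeight ξ = ∫⁻ p, fiberSum (fun θ => orbitWeight θ * h θ) p ∂fiberCount ξ := by
  rw [lintegral_fiberWeight hh, lintegral_fiberCount
    (f := fiberSum fun θ => orbitWeight θ * h θ)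
    (measurable_fiberSum (measurable_orbitWeight.mul hh)),
    tsum_primary_fiber fun θ => orbitWeight θ * h θ]

/-- The sum of `tameWeight`, counted with multiplicity, over the fibers of `rootPair`. This is
positive and bounded, although these fibers may be infinite. -/
def pairWeight : rootMoving → ℝ≥0∞ := fiberSum fun θ => orbitWeight θ * tameWeight θ

theorem measurable_pairWeight : Measurable pairWeight :=
  measurable_fiberSum (measurable_orbitWeight.mul measurable_tameWeight)

theorem pairWeight_ne_zero (p : rootMoving) : pairWeight p ≠ 0 := by
  obtain ⟨p, Γ, x, y, rfl⟩ := p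
  intro h
  have h1 := ENNReal.tsum_eq_zero.1 h ⟨cls₂ Γ x y,
    Subtype.ext (Prod.ext (primary_cls₂ Γ x y) (secondary_cls₂ Γ x y))⟩
  exact mul_ne_zero (orbitWeight_ne_zero _) (tameWeight_ne_zero _) h1

theorem lintegral_pairWeight_le (ξ : Gr₁) : ∫⁻ p, pairWeight p ∂fiberCount ξ ≤ 2 := by
  rw [pairWeight, ← lintegral_fiberWeight_eq_fiberCount measurable_tameWeight]
  exact lintegral_tameWeight_le ξ

theorem pairWeight_ne_top (p : rootMoving) : pairWeight p ≠ ∞ := by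
  refine ne_top_of_le_ne_top (by simp : (2 : ℝ≥0∞) ≠ ∞)
    (le_trans ?_ (lintegral_pairWeight_le p.1.1))
  rw [lintegral_fiberCount measurable_pairWeight]
  exact ENNReal.le_tsum (f := fun q : {q : rootMoving // q.1.1 = p.1.1} => pairWeight q) ⟨p, rfl⟩

/-- Measurability of the unweighted fiber measures. The image of a weighted fiber measure may
have infinite atoms; normalizing the weights to have sum `1` over each fiber of `rootPair` gives
the counting measure. -/
theorem measurable_fiberCount : Measurable fiberCount := by
  refine Measure.measurable_of_measurable_coe _ fun s hs => ?_
  have hg : Measurable fun p => s.indicator 1 p / pairWeight p :=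
    (measurable_one.indicator hs).div measurable_pairWeight
  have hm : Measurable fun θ =>
      tameWeight θ * (s.indicator 1 (rootPair θ) / pairWeight (rootPair θ)) :=
    measurable_tameWeight.mul (hg.comp measurable_rootPair)
  have h1 := measurable_lintegral_fiberWeight measurable_id (F := fun (_ : Gr₁) θ =>
    tameWeight θ * (s.indicator 1 (rootPair θ) / pairWeight (rootPair θ)))
    (hm.comp measurable_snd)
  convert h1 using 1
  funext ξ
  refine Eq.trans ?_ (lintegral_fiberWeight_eq_fiberCount hm ξ).symm
  rw [← lintegral_indicator_one hs]
  refine lintegral_congr fun p => ?_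
  simp_rw [← mul_assoc]
  rw [fiberSum_mul_comp (fun θ => orbitWeight θ * tameWeight θ)
    (fun p => s.indicator 1 p / pairWeight p)]
  exact (ENNReal.mul_div_cancel (pairWeight_ne_zero p) (pairWeight_ne_top p)).symm

/-! ### The counting measures -/

theorem lintegral_countingGr₂ (μ : Measure Gr₁) {h : Gr₂ → ℝ≥0∞} (hh : Measurable h) :
    ∫⁻ θ, h θ ∂countingGr₂ μ = ∫⁻ ξ, ∫⁻ θ, h θ ∂fiberWeight ξ ∂μ :=
  Measure.lintegral_bind measurable_fiberWeight.aemeasurable hh.aemeasurable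

theorem lintegral_countingR (μ : Measure Gr₁) {h : rootMoving → ℝ≥0∞} (hh : Measurable h) :
    ∫⁻ p, h p ∂countingR μ = ∫⁻ ξ, ∫⁻ p, h p ∂fiberCount ξ ∂μ :=
  Measure.lintegral_bind measurable_fiberCount.aemeasurable hh.aemeasurable

/-- Integration over doubly rooted graphs amounts to summing over the fibers of `rootPair`, with
multiplicity `orbitWeight`, and integrating over the equivalence relation. -/
theorem lintegral_countingGr₂_eq_countingR (μ : Measure Gr₁) {h : Gr₂ → ℝ≥0∞}
    (hh : Measurable h) :
    ∫⁻ θ, h θ ∂countingGr₂ μ = ∫⁻ p, fiberSum (fun θ => orbitWeight θ * h θ) p ∂countingR μ := by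
  rw [lintegral_countingGr₂ μ hh, lintegral_countingR μ
    (h := fiberSum fun θ => orbitWeight θ * h θ)
    (measurable_fiberSum (measurable_orbitWeight.mul hh))]
  exact lintegral_congr fun ξ => lintegral_fiberWeight_eq_fiberCount hh ξ

theorem sigmaFinite_of_pos_lintegral {X : Type*} [MeasurableSpace X] {m : Measure X}
    {f : X → ℝ≥0∞} (hf : Measurable f) (h0 : ∀ x, f x ≠ 0) (htop : ∀ x, f x ≠ ∞)
    (hint : ∫⁻ x, f x ∂m ≠ ∞) : SigmaFinite m := by
  have := isFiniteMeasure_withDensity hint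
  rw [← withDensity_inv_same (μ := m) hf (Filter.Eventually.of_forall h0) (Filter.Eventually.of_forall htop)]
  exact SigmaFinite.withDensity_of_ne_top (Filter.Eventually.of_forall fun x => by simp [h0 x])

/-- The measure `∫ κ ξ dμ(ξ)` for measures `κ ξ` on the fibers of a map `π` is `σ`-finite if there
is a positive function with bounded integrals over the fibers. -/
theorem sigmaFinite_bind {X : Type*} [MeasurableSpace X] {μ : Measure Gr₁} [SigmaFinite μ]
    {κ : Gr₁ → Measure X} (hκ : Measurable κ) {π : X → Gr₁} (hπ : Measurable π)
    (hκπ : ∀ ξ, ∀ᵐ a ∂κ ξ, π a = ξ) {f : X → ℝ≥0∞} (hf : Measurable f) (h0 : ∀ x, f x ≠ 0)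
    (htop : ∀ x, f x ≠ ∞) (hint : ∀ ξ, ∫⁻ x, f x ∂κ ξ ≤ 2) : SigmaFinite (μ.bind κ) := by
  -- Multiplying `f` with a positive integrable function on the base gives a positive integrable
  -- function for the integrated measure.
  obtain ⟨g, hg0, hgm, hg⟩ := exists_pos_lintegral_lt_of_sigmaFinite μ one_ne_zero
  refine sigmaFinite_of_pos_lintegral (f := fun x => g (π x) * f x)
    ((hgm.coe_nnreal_ennreal.comp hπ).mul hf)
    (fun x => mul_ne_zero (by simpa using (hg0 _).ne') (h0 x))
    (fun x => ENNReal.mul_ne_top (by simp) (htop x)) ?_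
  rw [Measure.lintegral_bind (f := fun x => g (π x) * f x) hκ.aemeasurable
    ((hgm.coe_nnreal_ennreal.comp hπ).mul hf).aemeasurable]
  have h1 : ∀ ξ, ∫⁻ x, g (π x) * f x ∂κ ξ ≤ g ξ * 2 := by
    intro ξ
    calc ∫⁻ x, g (π x) * f x ∂κ ξ = ∫⁻ x, g ξ * f x ∂κ ξ :=
          lintegral_congr_ae (by filter_upwards [hκπ ξ] with x hx; rw [hx])
      _ = g ξ * ∫⁻ x, f x ∂κ ξ := lintegral_const_mul _ hf
      _ ≤ g ξ * 2 := by gcongr; exact hint ξ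
  refine ne_top_of_le_ne_top ?_ (lintegral_mono h1)
  rw [lintegral_mul_const _ hgm.coe_nnreal_ennreal]
  exact ENNReal.mul_ne_top (hg.trans (by simp)).ne (by simp)

theorem ae_fst_eq (ξ : Gr₁) : ∀ᵐ p ∂fiberCount ξ, p.1.1 = ξ := by
  have hm : MeasurableSet {p : rootMoving | ¬ p.1.1 = ξ} :=
    (measurableSet_eq_fun (measurable_fst.comp measurable_subtype_coe) measurable_const).compl
  rw [ae_iff, ← lintegral_indicator_one hm, lintegral_fiberCount (measurable_one.indicator hm)]
  refine ENNReal.tsum_eq_zero.2 fun p => ?_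
  simp [Set.indicator, p.2]

instance (μ : Measure Gr₁) [SigmaFinite μ] : SigmaFinite (countingGr₂ μ) :=
  sigmaFinite_bind measurable_fiberWeight measurable_primary ae_primary_eq measurable_tameWeight
    tameWeight_ne_zero tameWeight_ne_top lintegral_tameWeight_le

instance (μ : Measure Gr₁) [SigmaFinite μ] : SigmaFinite (countingR μ) :=
  sigmaFinite_bind measurable_fiberCount (measurable_fst.comp measurable_subtype_coe) ae_fst_eq
    measurable_pairWeight pairWeight_ne_zero pairWeight_ne_top lintegral_pairWeight_le

/-! ### The Radon–Nikodym derivative -/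

theorem swapRoots_swapRoots (θ : Gr₂) : swapRoots (swapRoots θ) = θ := by
  obtain ⟨Γ, x, y, rfl⟩ := exists_cls₂ θ
  rw [swapRoots_cls₂, swapRoots_cls₂]

theorem rootPair_swapRoots (θ : Gr₂) : rootPair (swapRoots θ) = swapPair (rootPair θ) := by
  obtain ⟨Γ, x, y, rfl⟩ := exists_cls₂ θ
  refine Subtype.ext (Prod.ext ?_ ?_)
  · change primary (swapRoots (cls₂ Γ x y)) = secondary (cls₂ Γ x y)
    rw [swapRoots_cls₂, primary_cls₂, secondary_cls₂]
  · change secondary (swapRoots (cls₂ Γ x y)) = primary (cls₂ Γ x y)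
    rw [swapRoots_cls₂, primary_cls₂, secondary_cls₂]

theorem swapPair_swapPair (p : rootMoving) : swapPair (swapPair p) = p := rfl

theorem fiberSum_comp_swapRoots (h : Gr₂ → ℝ≥0∞) (p : rootMoving) :
    fiberSum (fun θ => h (swapRoots θ)) p = fiberSum h (swapPair p) := by
  let e : {θ // rootPair θ = p} ≃ {θ // rootPair θ = swapPair p} :=
    { toFun := fun θ => ⟨swapRoots θ.1, by rw [rootPair_swapRoots, θ.2]⟩
      invFun := fun θ => ⟨swapRoots θ.1, by rw [rootPair_swapRoots, θ.2, swapPair_swapPair]⟩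
      left_inv := fun θ => Subtype.ext (swapRoots_swapRoots θ.1)
      right_inv := fun θ => Subtype.ext (swapRoots_swapRoots θ.1) }
  exact e.tsum_eq fun θ => h θ.1

theorem modularFunction_eq (θ : Gr₂) :
    modularFunction θ = orbitWeight θ / orbitWeight (swapRoots θ) := by
  obtain ⟨Γ, x, y, rfl⟩ := exists_cls₂ θ
  rw [swapRoots_cls₂]
  rfl

theorem measurable_modularFunction : Measurable modularFunction := by
  rw [funext modularFunction_eq]
  exact measurable_orbitWeight.div (measurable_orbitWeight.comp measurable_swapRoots)

theorem orbitWeight_mul_div_modularFunction (θ : Gr₂) (c : ℝ≥0∞) :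
    orbitWeight θ * (c / modularFunction θ) = orbitWeight (swapRoots θ) * c := by
  rw [modularFunction_eq, div_eq_mul_inv, ENNReal.inv_div (Or.inl (orbitWeight_ne_top _))
    (Or.inl (orbitWeight_ne_zero _)), mul_left_comm,
    ENNReal.mul_div_cancel (orbitWeight_ne_zero _) (orbitWeight_ne_top _), mul_comm]

/-- A density of the swapped counting measure on the equivalence relation gives a density of the
swapped counting measure on doubly rooted graphs. -/
theorem map_swapRoots_countingGr₂ (μ : Measure Gr₁) {D : rootMoving → ℝ≥0∞} (hD : Measurable D)
    (h : (countingR μ).map swapPair = (countingR μ).withDensity D) :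
    (countingGr₂ μ).map swapRoots =
      (countingGr₂ μ).withDensity fun θ => D (rootPair θ) / modularFunction θ := by
  have hρ : Measurable fun θ => D (rootPair θ) / modularFunction θ :=
    (hD.comp measurable_rootPair).div measurable_modularFunction
  refine Measure.ext_of_lintegral _ fun f hf => ?_
  have hw : Measurable fun θ => orbitWeight (swapRoots θ) * f θ :=
    (measurable_orbitWeight.comp measurable_swapRoots).mul hf
  have hS := measurable_fiberSum hw
  rw [lintegral_map hf measurable_swapRoots, lintegral_withDensity_eq_lintegral_mul _ hρ hf,
    lintegral_countingGr₂_eq_countingR μ (h := fun θ => f (swapRoots θ)) (hf.comp measurable_swapRoots),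
    lintegral_countingGr₂_eq_countingR μ (hρ.mul hf)]
  calc ∫⁻ p, fiberSum (fun θ => orbitWeight θ * f (swapRoots θ)) p ∂countingR μ
      = ∫⁻ p, fiberSum (fun θ => orbitWeight (swapRoots θ) * f θ) (swapPair p) ∂countingR μ := by
        refine lintegral_congr fun p => ?_
        rw [← fiberSum_comp_swapRoots]
        simp_rw [swapRoots_swapRoots]
    _ = ∫⁻ p, (D * fiberSum fun θ => orbitWeight (swapRoots θ) * f θ) p ∂countingR μ := by
        rw [← lintegral_withDensity_eq_lintegral_mul _ hD hS, ← h,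
          lintegral_map hS measurable_swapPair]
    _ = _ := by
        refine lintegral_congr fun p => ?_
        rw [Pi.mul_apply, mul_comm, ← fiberSum_mul_comp]
        congr 1
        funext θ
        rw [Pi.mul_apply, ← mul_assoc, orbitWeight_mul_div_modularFunction, mul_right_comm]

end RandomGraphs

end

theorem mainTheorem2 (μ : Measure Gr₁) [SigmaFinite μ] (hμ : QuasiInvariant μ) :
    Measurable fiberCount ∧ Measurable fiberWeight ∧
    (countingR μ).map swapPair = (countingR μ).withDensity (rnCocycle μ) ∧
    QuasiUnimodular μ ∧
    (countingGr₂ μ).map swapRoots =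
      (countingGr₂ μ).withDensity (fun θ => rnCocycle μ (rootPair θ) / modularFunction θ) ∧
    ((countingGr₂ μ).map swapRoots).rnDeriv (countingGr₂ μ) =ᵐ[countingGr₂ μ]
      (fun θ => rnCocycle μ (rootPair θ) / modularFunction θ) := by
  have hD : Measurable (rnCocycle μ) := Measure.measurable_rnDeriv _ _
  have h1 : (countingR μ).map swapPair = (countingR μ).withDensity (rnCocycle μ) :=
    (Measure.withDensity_rnDeriv_eq _ _ hμ.1).symm
  have h2 := map_swapRoots_countingGr₂ μ hD h1
  have hac : (countingGr₂ μ).map swapRoots ≪ countingGr₂ μ := by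
    rw [h2]; exact withDensity_absolutelyContinuous _ _
  refine ⟨measurable_fiberCount, measurable_fiberWeight, h1, ⟨hac, ?_⟩, h2, ?_⟩
  -- The other half of the equivalence is the image of the first one under the involution.
  · have h3 := hac.map measurable_swapRoots
    rwa [Measure.map_map measurable_swapRoots measurable_swapRoots,
      show swapRoots ∘ swapRoots = id from funext swapRoots_swapRoots, Measure.map_id] at h3
  · rw [h2]
    exact Measure.rnDeriv_withDensity _
      ((hD.comp measurable_rootPair).div measurable_modularFunction)
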